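/- \textbf{Proposition (Uniqueness of Fourier magnitude retrieval).} Let $M=(M_1,\dots,M_d)$ be nonnegative integers, let $\mathcal M=\prod_{j=1}^d\{0,1,\dots,M_j\}\subset\mathbb Z^d$ be the object grid, and let $$\mathcal L=\Big\{w\in[0,1)^d:\ w_j\in\{0,\tfrac1{2M_j+1},\dots,\tfrac{2M_j}{2M_j+1}\}\Big\}$$ be the standard oversampled frequency grid, with $N=\prod_j(2M_j+1)$ points. Let $\Phi\in\mathbb C^{\mathcal L\times\mathcal M}$ be the oversampled discrete Fourier transform, $\Phi(w,n)=e^{-2\pi i\,n\cdot w}$, and for a mask $\mu\in\mathbb C^{\mathcal M}$ put $A^*=N^{-1/2}\,\Phi\,\mathrm{diag}(\mu)$. Let $x_0\in\mathbb C^{\mathcal M}$ be a given (deterministic) object of rank at least $2$, i.e. the convex hull in $\mathbb R^d$ of $\operatorname{supp}x_0$ has dimension at least $2$. Assume moreover that for each $j\in\{1,\dots,d\}$ the support of $x_0$ contains a point $n$ with $n_j=0$ or a point $n$ with $n_j=M_j$. Let $\mu(n)$, $n\in\mathcal M$, be independent random variables on the unit circle of $\mathbb C$, each with a continuous (that is,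 atomless) distribution. Then, almost surely, the following holds for every $\hat x\in\mathbb C^{\mathcal M}$: if at each $w\in\mathcal L$ where neither $A^*\hat x(w)$ nor $A^*x_0(w)$ vanishes one has $$\frac{A^*\hat x(w)}{|A^*\hat x(w)|}=\pm\frac{A^*x_0(w)}{|A^*x_0(w)|},$$ where the sign may depend on $w$ (and nothing is required at the other $w$), then $\hat x=c\,x_0$ for some constant $c\in\mathbb R$. -/

import Mathlib

open MeasureTheory ProbabilityTheory

/-- The object grid `{0, …, M 1} × ⋯ × {0, …, M d}`. -/
abbrev ObjGrid {d : ℕ} (M : Fin d → ℕ) : Type := (j : Fin d) → Fin (M j + 1)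

/-- Index set of the sampling grid of the standard oversampling: `k` stands for the frequency
`w` with coordinates `w j = k j / (2 * M j + 1)`. -/
abbrev PixelGrid {d : ℕ} (M : Fin d → ℕ) : Type := (j : Fin d) → Fin (2 * M j + 1)

/-- The oversampled `d`-dimensional discrete Fourier transform, the matrix with entries
`exp (-2 π i n · w)`. -/
noncomputable def oversampledDFT {d : ℕ} (M : Fin d → ℕ) :
    Matrix (PixelGrid M) (ObjGrid M) ℂ :=
  Matrix.of fun k n =>
    Complex.exp (-(2 * (Real.pi : ℂ) * Complex.I *
      ∑ j, ((n j : ℕ) : ℂ) * ((k j : ℕ) : ℂ) / (2 * (M j : ℂ) + 1)))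

/-- The one-mask propagation matrix `c Φ diag(mask)`, with `c` the inverse of the square root of
the number of pixels, so that it is isometric for a phase mask. -/
noncomputable def propagation {d : ℕ} (M : Fin d → ℕ) (mask : ObjGrid M → ℂ) :
    Matrix (PixelGrid M) (ObjGrid M) ℂ :=
  (((Real.sqrt (Fintype.card (PixelGrid M)))⁻¹ : ℝ) : ℂ) •
    (oversampledDFT M * Matrix.diagonal mask)

/-- The support of an object, as a set of points of `ℝ ^ d`. -/
def realSupport {d : ℕ} {M : Fin d → ℕ} (x : ObjGrid M → ℂ) : Set (Fin d → ℝ) :=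
  (fun (n : ObjGrid M) (j : Fin d) => ((n j : ℕ) : ℝ)) '' Function.support x

/-- An object has rank at least two if the convex hull of its support has dimension at least
two, the dimension of a convex set being that of its affine span. -/
def RankAtLeastTwo {d : ℕ} {M : Fin d → ℕ} (x : ObjGrid M → ℂ) : Prop :=
  2 ≤ Module.finrank ℝ (affineSpan ℝ (convexHull ℝ (realSupport x))).direction

/-- In every coordinate direction the support of the object meets at least one of the two
opposite faces of the object grid. -/
def TouchesFaces {d : ℕ} {M : Fin d → ℕ} (x : ObjGrid M → ℂ) : Prop :=
  ∀ j : Fin d, ∃ n : ObjGrid M, x n ≠ 0 ∧ ((n j : ℕ) = 0 ∨ (n j : ℕ) = M j)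

/-- The phase factors `z / |z|` of `u` and `v` agree up to a sign that may depend on the pixel;
at a pixel where `u` or `v` vanishes the phase may be adjusted freely, so nothing is required
there. -/
def SamePhaseUpToSign {ι : Type*} (u v : ι → ℂ) : Prop :=
  ∀ k, u k ≠ 0 → v k ≠ 0 →
    u k / (‖u k‖ : ℂ) = v k / (‖v k‖ : ℂ) ∨ u k / (‖u k‖ : ℂ) = -(v k / (‖v k‖ : ℂ))

open MvPolynomial

variable {d : ℕ} {M : Fin d → ℕ}

/-! ### Generating polynomials and conjugate reflection. -/

/-- The exponent vector of a grid point. -/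
noncomputable def gridExponent (n : ObjGrid M) : Fin d →₀ ℕ :=
  Finsupp.equivFunOnFinite.symm fun j => (n j : ℕ)

@[simp] lemma gridExponent_apply (n : ObjGrid M) (j : Fin d) : gridExponent n j = (n j : ℕ) := rfl

lemma gridExponent_injective : Function.Injective (gridExponent (M := M)) := by
  intro m n h
  ext j
  exact DFunLike.congr_fun h j

/-- The generating polynomial of an object. -/
noncomputable def toPoly (a : ObjGrid M → ℂ) : MvPolynomial (Fin d) ℂ :=
  ∑ n, monomial (gridExponent n) (a n)

/-- The point reflection of the object grid. -/
def gridRev (n : ObjGrid M) : ObjGrid M := fun j => (n j).rev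

@[simp] lemma gridRev_gridRev (n : ObjGrid M) : gridRev (gridRev n) = n := by
  ext j; simp [gridRev]

lemma gridRev_apply (n : ObjGrid M) (j : Fin d) : (gridRev n j : ℕ) = M j - (n j : ℕ) := by
  simp [gridRev, Fin.val_rev]

/-- The conjugate reflection of an object. -/
noncomputable def reflect (a : ObjGrid M → ℂ) : ObjGrid M → ℂ :=
  fun n => (starRingEnd ℂ) (a (gridRev n))

lemma coeff_toPoly (a : ObjGrid M → ℂ) (n : ObjGrid M) :
    coeff (gridExponent n) (toPoly a) = a n := by
  classical
  simp only [toPoly, coeff_sum, coeff_monomial]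
  rw [Finset.sum_eq_single n] <;> simp +contextual [gridExponent_injective.eq_iff]

lemma toPoly_injective : Function.Injective (toPoly (M := M)) := by
  intro a b h
  ext n
  rw [← coeff_toPoly a, h, coeff_toPoly]

lemma reflect_injective : Function.Injective (reflect (M := M)) := by
  intro a b h
  ext n
  exact (starRingEnd ℂ).injective (by simpa [reflect] using congrFun h (gridRev n))

lemma degreeOf_toPoly_le (a : ObjGrid M → ℂ) (j : Fin d) : degreeOf j (toPoly a) ≤ M j := by
  classical
  refine (degreeOf_sum_le j _ _).trans (Finset.sup_le fun n _ => ?_)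
  by_cases h : a n = 0
  · simp [h]
  · rw [degreeOf_monomial_eq _ _ h]
    exact Nat.lt_succ_iff.mp (n j).2

lemma le_degreeOf_toPoly {a : ObjGrid M → ℂ} {n : ObjGrid M} (h : a n ≠ 0) (j : Fin d) :
    (n j : ℕ) ≤ degreeOf j (toPoly a) :=
  monomial_le_degreeOf (m := gridExponent n) j (by rwa [mem_support_iff, coeff_toPoly])

lemma toPoly_smul (c : ℂ) (a : ObjGrid M → ℂ) :
    toPoly (fun n => c * a n) = C c * toPoly a := by
  simp [toPoly, Finset.mul_sum, C_mul_monomial]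

lemma reflect_smul (c : ℂ) (a : ObjGrid M → ℂ) :
    reflect (fun n => c * a n) = fun n => (starRingEnd ℂ) c * reflect a n := by
  ext n; simp [reflect]

lemma toPoly_update (a : ObjGrid M → ℂ) (n : ObjGrid M) (b : ℂ) :
    toPoly (Function.update a n b) =
      monomial (gridExponent n) b + toPoly (Function.update a n 0) := by
  classical
  simp only [toPoly]
  rw [← Finset.add_sum_erase _ _ (Finset.mem_univ n),
    ← Finset.add_sum_erase (a := n) (f := fun m => monomial (gridExponent m)
      (Function.update a n 0 m)) _ (Finset.mem_univ n)]
  simp only [Function.update_self, map_zero, zero_add]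
  congr 1
  refine Finset.sum_congr rfl fun m hm => ?_
  rw [Function.update_of_ne (Finset.ne_of_mem_erase hm),
    Function.update_of_ne (Finset.ne_of_mem_erase hm)]

lemma reflect_update (a : ObjGrid M → ℂ) (n : ObjGrid M) (b : ℂ) :
    reflect (Function.update a n b) =
      Function.update (reflect a) (gridRev n) ((starRingEnd ℂ) b) := by
  ext m
  by_cases h : m = gridRev n
  · subst h; simp [reflect]
  · have h' : gridRev m ≠ n := fun h' => h (by rw [← h', gridRev_gridRev])
    simp [reflect, Function.update_of_ne h, Function.update_of_ne h']

lemma coeff_toPoly_eq_zero_of_X_dvd {a : ObjGrid M → ℂ} {j : Fin d} (h : X j ∣ toPoly a)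
    {n : ObjGrid M} (hn : (n j : ℕ) = 0) : a n = 0 := by
  classical
  obtain ⟨q, hq⟩ := h
  rw [← coeff_toPoly a n, hq, coeff_X_mul', if_neg]
  simp [hn]

/-- A support point with `n j = 0` rules out the first divisibility; one with `n j = M j` is
reflected to coordinate `0` and rules out the second. -/
lemma not_X_dvd_both {a : ObjGrid M → ℂ} (ha : TouchesFaces a) (j : Fin d)
    (h : X j ∣ toPoly a) (h' : X j ∣ toPoly (reflect a)) : False := by
  obtain ⟨n, hn, h0 | h1⟩ := ha j
  · exact hn (coeff_toPoly_eq_zero_of_X_dvd h h0)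
  · have := coeff_toPoly_eq_zero_of_X_dvd h' (n := gridRev n) (by simp [gridRev_apply, h1])
    simp [reflect, hn] at this

/-! ### Coprimality implies uniqueness. -/

lemma eq_real_smul_of_noCommonPrime {u v : ObjGrid M → ℂ} (hu : u ≠ 0) (hface : TouchesFaces u)
    (hcop : ∀ p : MvPolynomial (Fin d) ℂ, p ∣ toPoly u → p ∣ toPoly (reflect u) → ¬Prime p)
    (h : toPoly v * toPoly (reflect u) = toPoly (reflect v) * toPoly u) :
    ∃ c : ℝ, v = fun n => (c : ℂ) * u n := by
  have h0 : toPoly (0 : ObjGrid M → ℂ) = 0 := by simp [toPoly]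
  have hr0 : reflect (0 : ObjGrid M → ℂ) = 0 := by ext; simp [reflect]
  have hU : toPoly u ≠ 0 := fun e => hu (toPoly_injective (e.trans h0.symm))
  have hU' : toPoly (reflect u) ≠ 0 := fun e =>
    hu (reflect_injective ((toPoly_injective (e.trans h0.symm)).trans hr0.symm))
  have hdvd : toPoly u ∣ toPoly v :=
    UniqueFactorizationMonoid.dvd_of_dvd_mul_left_of_no_prime_factors hU
      (fun {p} => hcop p) ⟨toPoly (reflect v), by rw [h, mul_comm]⟩
  obtain ⟨q, hq⟩ := hdvd
  have hq' : toPoly (reflect v) = toPoly (reflect u) * q := by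
    apply mul_right_cancel₀ hU
    rw [← h, hq]; ring
  have hqC : q = C (coeff 0 q) := by
    by_cases hq0 : q = 0
    · simp [hq0]
    rw [← totalDegree_eq_zero_iff_eq_C, totalDegree_eq_zero_iff]
    intro m hm j
    have h1 : degreeOf j (toPoly u) + degreeOf j q ≤ M j := by
      rw [← degreeOf_mul_eq hU hq0, ← hq]; exact degreeOf_toPoly_le v j
    have h2 : degreeOf j (toPoly (reflect u)) + degreeOf j q ≤ M j := by
      rw [← degreeOf_mul_eq hU' hq0, ← hq']; exact degreeOf_toPoly_le _ j
    have h3 : m j ≤ degreeOf j q := monomial_le_degreeOf j hm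
    -- One of `u`, `reflect u` already has full degree `M j` in `X j`, leaving degree zero for `q`.
    obtain ⟨n, hn, h4 | h4⟩ := hface j
    · have := le_degreeOf_toPoly (a := reflect u) (n := gridRev n) (by simpa [reflect] using hn) j
      rw [gridRev_apply, h4] at this
      omega
    · have := le_degreeOf_toPoly hn j
      omega
  set c := coeff 0 q
  have hv : v = fun n => c * u n := by
    apply toPoly_injective
    rw [hq, hqC, toPoly_smul, mul_comm]
  have hcc : (starRingEnd ℂ) c = c := by
    rw [hv, reflect_smul, toPoly_smul, hqC, mul_comm] at hq'
    exact C_injective _ _ (mul_left_cancel₀ hU' hq')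
  obtain ⟨r, hr⟩ := Complex.conj_eq_iff_real.mp hcc
  exact ⟨r, by rw [hv, hr]⟩

/-! ### Finiteness of the phases that allow a common prime. -/

lemma not_dvd_monomial_toPoly {a : ObjGrid M → ℂ} {m₁ m₂ : ObjGrid M} (hne : m₁ ≠ m₂)
    (h₁ : a m₁ ≠ 0) (h₂ : a m₂ ≠ 0) {e : Fin d →₀ ℕ} {c : ℂ} (hc : c ≠ 0) :
    ¬toPoly a ∣ monomial e c := by
  classical
  rw [dvd_monomial_iff_exists hc]
  rintro ⟨m, b, -, -, hm⟩
  rw [← coeff_toPoly a, hm, coeff_monomial] at h₁ h₂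
  have e₁ : m = gridExponent m₁ := by by_contra h; simp [h] at h₁
  have e₂ : m = gridExponent m₂ := by by_contra h; simp [h] at h₂
  exact hne (gridExponent_injective (e₁.symm.trans e₂))

lemma exists_X_dvd_of_prime_dvd_monomial {p : MvPolynomial (Fin d) ℂ} (hp : Prime p)
    {e : Fin d →₀ ℕ} {c : ℂ} (hc : c ≠ 0) (h : p ∣ monomial e c) : ∃ j, X j ∣ p := by
  obtain ⟨m, b, -, hb, rfl⟩ := (dvd_monomial_iff_exists hc).mp h
  have hb0 : b ≠ 0 := fun h => hc (by rwa [h, zero_dvd_iff] at hb)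
  by_contra! hj
  have hm : m = 0 := by
    ext j
    by_contra h
    exact hj j (X_dvd_monomial.mpr (Or.inr h))
  subst hm
  exact hp.not_isUnit (hb0.isUnit.map (C : ℂ →+* MvPolynomial (Fin d) ℂ))

/-- For unimodular `t`, every common divisor divides a nonzero polynomial `D` independent of `t`.
Each of the finitely many primes of `D` can serve at most one `t`. -/
lemma finite_phases_with_common_prime (a : ObjGrid M → ℂ) (n₀ : ObjGrid M) {b : ℂ} (hb : b ≠ 0)
    {m₁ m₂ : ObjGrid M} (hne : m₁ ≠ m₂) (hn₁ : m₁ ≠ n₀) (hn₂ : m₂ ≠ n₀)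
    (h₁ : a m₁ ≠ 0) (h₂ : a m₂ ≠ 0)
    (hface : ∀ t : ℂ, t ≠ 0 → TouchesFaces (Function.update a n₀ (t * b))) :
    {t : ℂ | ‖t‖ = 1 ∧ ∃ p : MvPolynomial (Fin d) ℂ,
      p ∣ toPoly (Function.update a n₀ (t * b)) ∧
      p ∣ toPoly (reflect (Function.update a n₀ (t * b))) ∧ Prime p}.Finite := by
  classical
  set R := toPoly (Function.update a n₀ 0) with hR
  set R' := toPoly (Function.update (reflect a) (gridRev n₀) 0) with hR'
  have hU : ∀ t, toPoly (Function.update a n₀ (t * b)) =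
      monomial (gridExponent n₀) (t * b) + R := fun t => toPoly_update _ _ _
  have hU' : ∀ t, toPoly (reflect (Function.update a n₀ (t * b))) =
      monomial (gridExponent (gridRev n₀)) ((starRingEnd ℂ) (t * b)) + R' := fun t => by
    rw [reflect_update, toPoly_update]
  set D := R * R' - monomial (gridExponent n₀ + gridExponent (gridRev n₀))
    (b * (starRingEnd ℂ) b) with hD
  have hbb : b * (starRingEnd ℂ) b ≠ 0 := by simp [hb]
  -- Otherwise `R` would divide a monomial, although `m₁` and `m₂` give it two terms.
  have hD0 : D ≠ 0 := by
    intro h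
    refine not_dvd_monomial_toPoly (a := Function.update a n₀ 0) hne ?_ ?_ hbb
      ⟨R', (sub_eq_zero.mp h).symm⟩
    · rwa [Function.update_of_ne hn₁]
    · rwa [Function.update_of_ne hn₂]
  have hdvdD : ∀ t : ℂ, ‖t‖ = 1 → ∀ p : MvPolynomial (Fin d) ℂ,
      p ∣ toPoly (Function.update a n₀ (t * b)) →
      p ∣ toPoly (reflect (Function.update a n₀ (t * b))) → p ∣ D := by
    intro t ht p hp hp'
    have htt : t * (starRingEnd ℂ) t = 1 := by
      rw [Complex.mul_conj, Complex.normSq_eq_norm_sq, ht]; simp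
    have hmm : (monomial (gridExponent n₀ + gridExponent (gridRev n₀))
        (b * (starRingEnd ℂ) b) : MvPolynomial (Fin d) ℂ) =
        monomial (gridExponent n₀) (t * b) *
          monomial (gridExponent (gridRev n₀)) ((starRingEnd ℂ) (t * b)) := by
      rw [monomial_mul]
      congr 1
      rw [map_mul]
      linear_combination (-(b * (starRingEnd ℂ) b)) * htt
    have : D = toPoly (Function.update a n₀ (t * b)) * R' -
        monomial (gridExponent n₀) (t * b) *
          toPoly (reflect (Function.update a n₀ (t * b))) := by
      rw [hD, hmm, hU, hU']; ring
    rw [this]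
    exact dvd_sub (hp.mul_right _) (hp'.mul_left _)
  have hsub : ∀ p : MvPolynomial (Fin d) ℂ, Prime p →
      {t : ℂ | ‖t‖ = 1 ∧ p ∣ toPoly (Function.update a n₀ (t * b)) ∧
        p ∣ toPoly (reflect (Function.update a n₀ (t * b)))}.Subsingleton := by
    rintro p hp t ⟨ht, h, h'⟩ s ⟨-, k, -⟩
    by_contra hts
    -- `R` cancels between the two phases, so `p` divides a monomial and hence is divisible by a
    -- variable, which the face condition forbids.
    have hdiff : p ∣ monomial (gridExponent n₀) ((t - s) * b) := by
      have := dvd_sub h k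
      rw [hU, hU, add_sub_add_right_eq_sub, ← map_sub, ← sub_mul] at this
      exact this
    obtain ⟨j, hj⟩ := exists_X_dvd_of_prime_dvd_monomial hp
      (mul_ne_zero (sub_ne_zero.mpr hts) hb) hdiff
    have ht0 : t ≠ 0 := by rintro rfl; simp at ht
    exact not_X_dvd_both (hface t ht0) j (hj.trans h) (hj.trans h')
  refine ((UniqueFactorizationMonoid.factors D).toFinset.finite_toSet.biUnion (t := fun p =>
    {t : ℂ | ‖t‖ = 1 ∧ p ∣ toPoly (Function.update a n₀ (t * b)) ∧
        p ∣ toPoly (reflect (Function.update a n₀ (t * b)))}) fun p hp =>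
      (hsub p ?_).finite).subset ?_
  · exact UniqueFactorizationMonoid.prime_of_factor p (by simpa using hp)
  · rintro t ⟨ht, p, h, h', hp⟩
    obtain ⟨q, hq, hpq⟩ := UniqueFactorizationMonoid.exists_mem_factors_of_dvd hD0 hp.irreducible
      (hdvdD t ht p h h')
    exact Set.mem_biUnion (by simpa using hq) ⟨ht, hpq.dvd_iff_dvd_left.mp h,
      hpq.dvd_iff_dvd_left.mp h'⟩
-- Sampling on the torus.
/-- The `k`-th node `exp (-2 π i k / (2 m + 1))` of the one-dimensional sampling grid. -/
noncomputable def samplingNode (m : ℕ) (k : Fin (2 * m + 1)) : ℂ :=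
  Complex.exp (-(2 * (Real.pi : ℂ) * Complex.I * ((k : ℕ) : ℂ) / (2 * (m : ℂ) + 1)))

lemma norm_samplingNode (m : ℕ) (k : Fin (2 * m + 1)) : ‖samplingNode m k‖ = 1 := by
  rw [samplingNode, show -(2 * (Real.pi : ℂ) * Complex.I * ((k : ℕ) : ℂ) / (2 * (m : ℂ) + 1)) =
    ((-(2 * Real.pi * (k : ℕ) / (2 * m + 1)) : ℝ) : ℂ) * Complex.I by push_cast; ring]
  exact Complex.norm_exp_ofReal_mul_I _

lemma samplingNode_injective (m : ℕ) : Function.Injective (samplingNode m) := by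
  have hprim := (Complex.isPrimitiveRoot_exp (2 * m + 1) (by omega)).inv
  have hpow : ∀ k : Fin (2 * m + 1), samplingNode m k =
      (Complex.exp (2 * Real.pi * Complex.I / ((2 * m + 1 : ℕ) : ℂ)))⁻¹ ^ (k : ℕ) := fun k => by
    rw [samplingNode, ← Complex.exp_neg, ← Complex.exp_nat_mul]
    congr 1
    push_cast
    ring
  intro k l h
  rw [hpow, hpow] at h
  exact Fin.ext (hprim.pow_inj k.2 l.2 h)

lemma oversampledDFT_eq_prod (k : PixelGrid M) (n : ObjGrid M) :
    oversampledDFT M k n = ∏ j, samplingNode (M j) (k j) ^ (n j : ℕ) := by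
  simp only [oversampledDFT, Matrix.of_apply, samplingNode, ← Complex.exp_nat_mul]
  rw [← Complex.exp_sum, Finset.mul_sum, ← Finset.sum_neg_distrib]
  congr 1
  refine Finset.sum_congr rfl fun j _ => ?_
  ring

lemma eval_toPoly (z : Fin d → ℂ) (a : ObjGrid M → ℂ) :
    eval z (toPoly a) = ∑ n, a n * ∏ j, z j ^ (n j : ℕ) := by
  simp only [toPoly, map_sum, eval_monomial]
  refine Finset.sum_congr rfl fun n _ => ?_
  rw [Finsupp.prod_fintype _ _ (by simp)]
  rfl

lemma eval_toPoly_reflect {z : Fin d → ℂ} (hz : ∀ j, ‖z j‖ = 1) (a : ObjGrid M → ℂ) :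
    eval z (toPoly (reflect a)) =
      (∏ j, z j ^ M j) * (starRingEnd ℂ) (eval z (toPoly a)) := by
  rw [eval_toPoly, eval_toPoly, map_sum, Finset.mul_sum]
  refine Finset.sum_nbij' gridRev gridRev (by simp) (by simp) (by simp) (by simp) fun n _ => ?_
  rw [map_mul, map_prod, mul_left_comm, ← Finset.prod_mul_distrib]
  refine congrArg₂ _ rfl (Finset.prod_congr rfl fun j _ => ?_)
  have hzz : z j * (starRingEnd ℂ) (z j) = 1 := by
    rw [Complex.mul_conj, Complex.normSq_eq_norm_sq, hz]; simp
  have hn : (n j : ℕ) ≤ M j := Nat.lt_succ_iff.mp (n j).2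
  rw [gridRev_apply, map_pow]
  nth_rw 2 [← Nat.add_sub_cancel' hn]
  rw [pow_add, mul_assoc, ← mul_pow, hzz, one_pow, mul_one]

lemma propagation_mulVec (mask x : ObjGrid M → ℂ) (k : PixelGrid M) :
    (propagation M mask).mulVec x k =
      (((Real.sqrt (Fintype.card (PixelGrid M)))⁻¹ : ℝ) : ℂ) *
        eval (fun j => samplingNode (M j) (k j)) (toPoly fun n => mask n * x n) := by
  rw [eval_toPoly, propagation, Matrix.smul_mulVec, Pi.smul_apply, smul_eq_mul]
  congr 1
  rw [Matrix.mulVec, dotProduct]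
  refine Finset.sum_congr rfl fun n _ => ?_
  rw [Matrix.mul_diagonal, oversampledDFT_eq_prod]
  ring

/-- Both sides have degree at most `2 * M j` in `X j`, while there are `2 * M j + 1` distinct nodes
in that direction. -/
lemma toPoly_mul_reflect_eq (u v : ObjGrid M → ℂ)
    (h : ∀ k : PixelGrid M, (eval (fun j => samplingNode (M j) (k j)) (toPoly v) *
      (starRingEnd ℂ) (eval (fun j => samplingNode (M j) (k j)) (toPoly u))).im = 0) :
    toPoly v * toPoly (reflect u) = toPoly (reflect v) * toPoly u := by
  classical
  rw [← sub_eq_zero]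
  refine eq_zero_of_eval_zero_at_prod_finset _
    (fun j => Finset.univ.image (samplingNode (M j))) (fun j => ?_) fun z hz => ?_
  · rw [Finset.card_image_of_injective _ (samplingNode_injective _), Finset.card_univ,
      Fintype.card_fin]
    refine Nat.lt_succ_iff.mpr ((degreeOf_sub_le _ _ _).trans (max_le ?_ ?_)) <;>
    · refine (degreeOf_mul_le _ _ _).trans ?_
      rw [two_mul]
      exact add_le_add (degreeOf_toPoly_le _ _) (degreeOf_toPoly_le _ _)
  · simp only [Finset.mem_image, Finset.mem_univ, true_and] at hz
    choose k hk using hz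
    obtain rfl : (fun j => samplingNode (M j) (k j)) = z := funext hk
    have hreal := Complex.conj_eq_iff_im.mpr (h k)
    rw [map_mul, Complex.conj_conj] at hreal
    rw [map_sub, map_mul, map_mul, eval_toPoly_reflect fun j => norm_samplingNode _ _,
      eval_toPoly_reflect fun j => norm_samplingNode _ _]
    linear_combination -(∏ j, samplingNode (M j) (k j) ^ M j) * hreal

lemma propagation_linear (mask x y : ObjGrid M → ℂ) (r s : ℝ) (k : PixelGrid M) :
    (propagation M mask).mulVec (r • x + s • y) k =
      (r : ℂ) * (propagation M mask).mulVec x k + (s : ℂ) * (propagation M mask).mulVec y k := by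
  simp [Matrix.mulVec_add, Matrix.mulVec_smul]

lemma eq_real_smul_of_im_eq_zero {mask x₀ x : ObjGrid M → ℂ} (hmask : ∀ n, mask n ≠ 0)
    (hx₀ : x₀ ≠ 0) (hface : TouchesFaces x₀)
    (hcop : ∀ p : MvPolynomial (Fin d) ℂ, p ∣ toPoly (fun n => mask n * x₀ n) →
      p ∣ toPoly (reflect fun n => mask n * x₀ n) → ¬Prime p)
    (h : ∀ k, ((propagation M mask).mulVec x k *
      (starRingEnd ℂ) ((propagation M mask).mulVec x₀ k)).im = 0) :
    ∃ c : ℝ, x = fun n => (c : ℂ) * x₀ n := by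
  have hid : toPoly (fun n => mask n * x n) * toPoly (reflect fun n => mask n * x₀ n) =
      toPoly (reflect fun n => mask n * x n) * toPoly (fun n => mask n * x₀ n) := by
    refine toPoly_mul_reflect_eq _ _ fun k => ?_
    have hk := h k
    have hcard : (0 : ℝ) < (Real.sqrt (Fintype.card (PixelGrid M)))⁻¹ := by
      have : 0 < Fintype.card (PixelGrid M) := Fintype.card_pos
      positivity
    rw [propagation_mulVec, propagation_mulVec, map_mul, Complex.conj_ofReal, mul_mul_mul_comm,
      ← Complex.ofReal_mul, Complex.im_ofReal_mul] at hk
    exact (mul_eq_zero.mp hk).resolve_left (mul_pos hcard hcard).ne'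
  obtain ⟨c, hc⟩ := eq_real_smul_of_noCommonPrime
    (fun e => hx₀ (funext fun n => by simpa [hmask n] using congrFun e n))
    (fun j => by
      obtain ⟨n, hn, hj⟩ := hface j
      exact ⟨n, mul_ne_zero (hmask n) hn, hj⟩) hcop hid
  refine ⟨c, funext fun n => mul_left_cancel₀ (hmask n) ?_⟩
  rw [congrFun hc n]
  ring

/-! ### The exceptional set of masks and its closedness. -/

/-- The phase masks for which some normalized object, orthogonal to `x₀` over the reals, has the
same Fourier phases up to sign as `x₀`. -/
def ambiguousMasks (x₀ : ObjGrid M → ℂ) : Set (ObjGrid M → ℂ) :=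
  {mask | (∀ n, ‖mask n‖ = 1) ∧ ∃ x : ObjGrid M → ℂ, x ∈ Metric.sphere 0 1 ∧
    (∑ n, x n * (starRingEnd ℂ) (x₀ n)).re = 0 ∧
    ∀ k, ((propagation M mask).mulVec x k *
      (starRingEnd ℂ) ((propagation M mask).mulVec x₀ k)).im = 0}

lemma continuous_propagation_mulVec {Y : Type*} [TopologicalSpace Y] {f g : Y → ObjGrid M → ℂ}
    (hf : Continuous f) (hg : Continuous g) (k : PixelGrid M) :
    Continuous fun y => (propagation M (f y)).mulVec (g y) k := by
  simp only [propagation_mulVec, eval_toPoly]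
  fun_prop

/-- Projection along a compact factor is a closed map; normalizing `x` to the unit sphere supplies
the compactness. -/
lemma isClosed_ambiguousMasks (x₀ : ObjGrid M → ℂ) : IsClosed (ambiguousMasks x₀) := by
  have : CompactSpace (Metric.sphere (0 : ObjGrid M → ℂ) 1) :=
    isCompact_iff_compactSpace.mp (isCompact_sphere _ _)
  set T : Set (Metric.sphere (0 : ObjGrid M → ℂ) 1 × (ObjGrid M → ℂ)) :=
    {q | (∀ n, ‖q.2 n‖ = 1) ∧ (∑ n, q.1.1 n * (starRingEnd ℂ) (x₀ n)).re = 0 ∧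
      ∀ k, ((propagation M q.2).mulVec q.1.1 k *
        (starRingEnd ℂ) ((propagation M q.2).mulVec x₀ k)).im = 0} with hT
  have hTc : IsClosed T := by
    have c1 : ∀ k, Continuous fun q : Metric.sphere (0 : ObjGrid M → ℂ) 1 × (ObjGrid M → ℂ) =>
        (propagation M q.2).mulVec q.1.1 k :=
      continuous_propagation_mulVec continuous_snd (by fun_prop)
    have c2 : ∀ k, Continuous fun q : Metric.sphere (0 : ObjGrid M → ℂ) 1 × (ObjGrid M → ℂ) =>
        (propagation M q.2).mulVec x₀ k :=
      continuous_propagation_mulVec continuous_snd (by fun_prop)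
    simp only [hT, Set.ofPred_and, Set.ofPred_forall]
    refine (isClosed_iInter fun n => isClosed_eq (by fun_prop) continuous_const).inter
      ((isClosed_eq ?_ continuous_const).inter
        (isClosed_iInter fun k => isClosed_eq ?_ continuous_const))
    · exact Complex.continuous_re.comp (continuous_finsetSum _ fun n _ =>
        ((continuous_apply n).comp (continuous_subtype_val.comp continuous_fst)).mul continuous_const)
    · exact Complex.continuous_im.comp ((c1 k).mul (Complex.continuous_conj.comp (c2 k)))
  convert isClosedMap_snd_of_compactSpace T hTc using 1
  ext mask
  constructor
  · rintro ⟨h1, x, hx, h2, h3⟩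
    exact ⟨(⟨x, hx⟩, mask), ⟨h1, h2, h3⟩, rfl⟩
  · rintro ⟨⟨x, _⟩, ⟨h1, h2, h3⟩, rfl⟩
    exact ⟨h1, x.1, x.2, h2, h3⟩

/-- The condition is real-linear in `x` and holds for `x₀`, so it survives removing the real
projection onto `x₀` and normalizing; a nonzero remainder would make the mask ambiguous. -/
lemma eq_real_smul_of_notMem_ambiguousMasks {mask x₀ x : ObjGrid M → ℂ} (hx₀ : x₀ ≠ 0)
    (hnorm : ∀ n, ‖mask n‖ = 1) (hmask : mask ∉ ambiguousMasks x₀)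
    (h : ∀ k, ((propagation M mask).mulVec x k *
      (starRingEnd ℂ) ((propagation M mask).mulVec x₀ k)).im = 0) :
    ∃ c : ℝ, x = fun n => (c : ℂ) * x₀ n := by
  set s : ℝ := ∑ n, Complex.normSq (x₀ n) with hs
  have hs0 : s ≠ 0 := by
    obtain ⟨n, hn⟩ := Function.ne_iff.mp hx₀
    exact (Finset.sum_pos' (fun n _ => Complex.normSq_nonneg _)
      ⟨n, Finset.mem_univ n, Complex.normSq_pos.mpr hn⟩).ne'
  set c : ℝ := (∑ n, x n * (starRingEnd ℂ) (x₀ n)).re / s with hc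
  set y : ObjGrid M → ℂ := x - c • x₀ with hy
  suffices hy0 : y = 0 from ⟨c, by
    rw [sub_eq_zero.mp hy0]; ext n; simp⟩
  by_contra hy0
  have hyn : ‖y‖ ≠ 0 := norm_ne_zero_iff.mpr hy0
  refine hmask ⟨hnorm, ‖y‖⁻¹ • y, ?_, ?_, fun k => ?_⟩
  · simp [norm_smul, hyn]
  · have h1 : ∑ n, (‖y‖⁻¹ • y) n * (starRingEnd ℂ) (x₀ n) = ((‖y‖⁻¹ : ℝ) : ℂ) *
        (∑ n, x n * (starRingEnd ℂ) (x₀ n) - (c : ℂ) * (s : ℂ)) := by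
      rw [hs, Complex.ofReal_sum, Finset.mul_sum, ← Finset.sum_sub_distrib, Finset.mul_sum]
      refine Finset.sum_congr rfl fun n _ => ?_
      rw [← Complex.mul_conj]
      simp only [hy, Pi.smul_apply, Pi.sub_apply, Complex.real_smul]
      ring
    rw [h1, Complex.re_ofReal_mul, ← Complex.ofReal_mul, Complex.sub_re, Complex.ofReal_re, hc,
      div_mul_cancel₀ _ hs0, sub_self, mul_zero]
  · have h2 : ‖y‖⁻¹ • y = ‖y‖⁻¹ • x + (-(‖y‖⁻¹ * c)) • x₀ := by
      rw [hy, smul_sub, neg_smul, mul_smul, sub_eq_add_neg]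
    rw [h2, propagation_linear, add_mul, mul_assoc, mul_assoc, Complex.mul_conj, Complex.add_im,
      Complex.im_ofReal_mul, h k, Complex.im_ofReal_mul, Complex.ofReal_im, mul_zero, mul_zero,
      add_zero]

lemma finite_ambiguous_phases {x₀ : ObjGrid M → ℂ} (hface : TouchesFaces x₀) {n₀ m₁ m₂ : ObjGrid M}
    (h₀ : x₀ n₀ ≠ 0) (hne : m₁ ≠ m₂) (hn₁ : m₁ ≠ n₀) (hn₂ : m₂ ≠ n₀)
    (h₁ : x₀ m₁ ≠ 0) (h₂ : x₀ m₂ ≠ 0) (mask : ObjGrid M → ℂ) :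
    {t : ℂ | Function.update mask n₀ t ∈ ambiguousMasks x₀}.Finite := by
  classical
  by_cases hmask : ∀ n, n ≠ n₀ → ‖mask n‖ = 1
  swap
  -- A non-unimodular entry away from `n₀` makes the section empty.
  · push Not at hmask
    obtain ⟨n, hn, hn1⟩ := hmask
    convert Set.finite_empty
    refine Set.eq_empty_of_forall_notMem fun t ht => hn1 ?_
    simpa [Function.update_of_ne hn] using ht.1 n
  have hupd : ∀ t, (fun n => Function.update mask n₀ t n * x₀ n) =
      Function.update (fun n => mask n * x₀ n) n₀ (t * x₀ n₀) := fun t => by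
    ext n
    by_cases hn : n = n₀
    · subst hn; simp
    · simp [Function.update_of_ne hn]
  have hne0 : ∀ n, n ≠ n₀ → mask n ≠ 0 := fun n hn h => by simpa [h] using hmask n hn
  refine (finite_phases_with_common_prime (fun n => mask n * x₀ n) n₀ h₀ hne hn₁ hn₂
    (mul_ne_zero (hne0 _ hn₁) h₁) (mul_ne_zero (hne0 _ hn₂) h₂) fun t ht j => ?_).subset ?_
  · obtain ⟨n, hn, hj⟩ := hface j
    refine ⟨n, ?_, hj⟩
    rw [← hupd]
    refine mul_ne_zero ?_ hn
    by_cases hnn : n = n₀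
    · subst hnn; simpa using ht
    · simpa [Function.update_of_ne hnn] using hne0 n hnn
  · rintro t ⟨hnorm, x, hx, horth, him⟩
    refine ⟨by simpa using hnorm n₀, ?_⟩
    by_contra! hcop
    obtain ⟨c, rfl⟩ := eq_real_smul_of_im_eq_zero (fun n h => by simpa [h] using hnorm n)
      (fun e => h₀ (congrFun e n₀)) hface (by simpa only [hupd] using hcop) him
    have hre : (∑ n, (c : ℂ) * x₀ n * (starRingEnd ℂ) (x₀ n)).re =
        c * ∑ n, Complex.normSq (x₀ n) := by
      rw [Finset.mul_sum, Complex.re_sum]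
      refine Finset.sum_congr rfl fun n _ => ?_
      rw [mul_assoc, Complex.mul_conj, Complex.re_ofReal_mul, Complex.ofReal_re]
    have hpos : 0 < ∑ n, Complex.normSq (x₀ n) :=
      Finset.sum_pos' (fun n _ => Complex.normSq_nonneg _)
        ⟨n₀, Finset.mem_univ n₀, Complex.normSq_pos.mpr h₀⟩
    -- A real multiple of `x₀` orthogonal to `x₀` is zero, hence not on the sphere.
    rw [hre] at horth
    have hc0 := (mul_eq_zero.mp horth).resolve_right hpos.ne'
    subst hc0
    simp [← Pi.zero_def] at hx

/-! ### Null sets with finite sections, and the conclusion. -/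

lemma measure_pi_eq_zero_of_finite_sections {ι : Type*} [Fintype ι] [DecidableEq ι]
    (ν : ι → Measure ℂ) [∀ i, IsProbabilityMeasure (ν i)] {S : Set (ι → ℂ)}
    (hS : MeasurableSet S) (i : ι) [NullSingletonClass (ν i)]
    (hfin : ∀ z, {t : ℂ | Function.update z i t ∈ S}.Finite) :
    Measure.pi ν S = 0 := by
  have hind : Measurable (S.indicator (1 : (ι → ℂ) → ENNReal)) := measurable_one.indicator hS
  -- Coordinate `i` is integrated first, so that the inner integral already vanishes.
  rw [← lintegral_indicator_one hS, lintegral_eq_lmarginal_univ (0 : ι → ℂ),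
    lmarginal_erase' _ hind (Finset.mem_univ i)]
  have h0 : (fun z : ι → ℂ => ∫⁻ t, S.indicator 1 (Function.update z i t) ∂ν i) = 0 := by
    ext z
    have hz : MeasurableSet {t : ℂ | Function.update z i t ∈ S} := (hfin z).measurableSet
    have : (fun t => S.indicator (1 : (ι → ℂ) → ENNReal) (Function.update z i t)) =
        {t : ℂ | Function.update z i t ∈ S}.indicator 1 := rfl
    rw [this, lintegral_indicator_one hz, (hfin z).measure_zero]
    rfl
  rw [h0]
  simp [lmarginal]

/-- Rank enters only here: it yields `n₀` and two further support points. -/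
lemma RankAtLeastTwo.not_support_subset_pair {x : ObjGrid M → ℂ} (hx : RankAtLeastTwo x)
    (m n : ObjGrid M) : ¬Function.support x ⊆ {m, n} := by
  intro h
  rw [RankAtLeastTwo, affineSpan_convexHull, direction_affineSpan] at hx
  have hc : Collinear ℝ (realSupport x) := by
    refine (collinear_pair ℝ (fun j => ((m j : ℕ) : ℝ)) fun j => ((n j : ℕ) : ℝ)).subset ?_
    rw [← Set.image_pair (fun (n : ObjGrid M) (j : Fin d) => ((n j : ℕ) : ℝ))]
    exact Set.image_mono h
  have := collinear_iff_finrank_le_one.mp hc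
  omega

lemma SamePhaseUpToSign.im_mul_conj_eq_zero {ι : Type*} {u v : ι → ℂ} (h : SamePhaseUpToSign u v)
    (k : ι) : (u k * (starRingEnd ℂ) (v k)).im = 0 := by
  by_cases hu : u k = 0
  · simp [hu]
  by_cases hv : v k = 0
  · simp [hv]
  have hu' : (‖u k‖ : ℂ) ≠ 0 := by simpa using hu
  obtain ⟨r, hr⟩ : ∃ r : ℝ, u k = r * v k := by
    rcases h k hu hv with e | e
    · refine ⟨‖u k‖ / ‖v k‖, ?_⟩
      rw [div_eq_iff hu'] at e
      conv_lhs => rw [e]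
      push_cast
      ring
    · refine ⟨-(‖u k‖ / ‖v k‖), ?_⟩
      rw [div_eq_iff hu'] at e
      conv_lhs => rw [e]
      push_cast
      ring
  rw [hr, mul_assoc, Complex.mul_conj, Complex.im_ofReal_mul, Complex.ofReal_im, mul_zero]

theorem mainTheorem3 {d : ℕ} (M : Fin d → ℕ)
    (x₀ : ObjGrid M → ℂ) (hrank : RankAtLeastTwo x₀) (hface : TouchesFaces x₀)
    {Ω : Type*} [MeasurableSpace Ω] (P : Measure Ω) [IsProbabilityMeasure P]
    (mu : ObjGrid M → Ω → ℂ)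
    (hmeas : ∀ n, Measurable (mu n))
    (hphase : ∀ n ω, ‖mu n ω‖ = 1)
    (hindep : iIndepFun mu P)
    (hcont : ∀ n, ∀ z : ℂ, P {ω | mu n ω = z} = 0) :
    ∀ᵐ ω ∂P, ∀ x : ObjGrid M → ℂ,
      SamePhaseUpToSign ((propagation M (fun n => mu n ω)).mulVec x)
        ((propagation M (fun n => mu n ω)).mulVec x₀) →
      ∃ c : ℝ, x = fun n => (c : ℂ) * x₀ n := by
  classical
  have hex : ∀ m n : ObjGrid M, ∃ l, x₀ l ≠ 0 ∧ l ≠ m ∧ l ≠ n := fun m n => by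
    obtain ⟨l, hl, hmn⟩ := Set.not_subset.mp (hrank.not_support_subset_pair m n)
    simp only [Set.mem_insert_iff, Set.mem_singleton_iff, not_or] at hmn
    exact ⟨l, hl, hmn⟩
  obtain ⟨n₀, h₀, -⟩ := hex 0 0
  obtain ⟨m₁, h₁, hn₁, -⟩ := hex n₀ n₀
  obtain ⟨m₂, h₂, hn₂, hne⟩ := hex n₀ m₁
  have hprob : ∀ n, IsProbabilityMeasure (P.map (mu n)) := fun n =>
    Measure.isProbabilityMeasure_map (hmeas n).aemeasurable
  have hatom : NullSingletonClass (P.map (mu n₀)) := ⟨fun z => by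
    rw [Measure.map_apply (hmeas n₀) (measurableSet_singleton z)]
    exact hcont n₀ z⟩
  have hS := (isClosed_ambiguousMasks x₀).measurableSet
  -- By independence the joint law of the mask is the product of its marginals.
  have hnull : P {ω | (fun n => mu n ω) ∈ ambiguousMasks x₀} = 0 := by
    have := measure_pi_eq_zero_of_finite_sections (fun n => P.map (mu n)) hS n₀
      (finite_ambiguous_phases hface h₀ hne.symm hn₁ hn₂ h₁ h₂)
    rwa [← (iIndepFun_iff_map_fun_eq_pi_map fun n => (hmeas n).aemeasurable).mp hindep,
      Measure.map_apply (measurable_pi_lambda _ hmeas) hS] at this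
  filter_upwards [measure_eq_zero_iff_ae_notMem.mp hnull] with ω hω x hx
  exact eq_real_smul_of_notMem_ambiguousMasks (fun e => h₀ (congrFun e n₀))
    (fun n => hphase n ω) hω hx.im_mul_conj_eq_zero
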